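/- Let $d\ge 2$, let $T$ be the $d$-regular rooted tree, whose vertices are the finite words over an alphabet of $d$ letters (the root is the empty word, and the children of $v$ are the words $vx$ with $x$ a letter), and let $\partial T$ be the set of infinite rays starting at the root. For a vertex $v$ let $T_v$ be the subtree of words with prefix $v$, identified with $T$ by $vw\leftrightarrow w$. Let $G\le \mathrm{Aut}(T)$ be a finitely generated regular branch group, that is: (i) $G$ acts transitively on each level of $T$; (ii) $G$ is self-similar: for every vertex $v$, the set of restrictions $g|_{T_v}$, $g\in \mathrm{Stab}_G(v)$, regarded as a subset of $\mathrm{Aut}(T)$, equals $G$; (iii) there is a finite index subgroup $K\le G$ such that $K^d$ is contained, as a subgroup of finite index, in $\psi_1(K\cap \mathrm{Stab}_G(1))$, where $\mathrm{Stab}_G(1)$ is the pointwise stabilizer of the first level $\{v_1,\dots,v_d\}$ and $\psi_1(g)=(g|_{T_{v_1}},\dots,g|_{T_{v_d}})$. Suppose that $G$ contains a finite subgroup $Q$ that does not fix any point of $\partial T$. Call a subgroup of $G$ weakly maximal if it is maximal among the subgroups of infinite index, call two subgroups of $G$ automorphism equivalent if some automorphism of $G$ maps one onto the other, and call the stabilizers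 in $G$ of the points of $\partial T$ parabolic subgroups. Then there are uncountably many automorphism equivalence classes of weakly maximal subgroups of $G$ that are different from the automorphism equivalence class of every parabolic subgroup of $G$. -/

import Mathlib

/-- The automorphism group of the `d`-regular rooted tree `T`. The vertices of `T` are the finite
words over `Fin d`, the root is the empty word, the vertices of level `n` are the words of length
`n`, and the children of `v` are the words `v ++ [x]`. A vertex `w` lies in the subtree hanging
at `v` iff the word `v` is a prefix of `w`; a rooted tree automorphism is a bijection of the
vertices that preserves and reflects this order. -/
abbrev TreeAut (d : ℕ) : Type :=
  RelIso (fun v w : List (Fin d) => v <+: w) (fun v w : List (Fin d) => v <+: w)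

namespace TreeAut

variable {d : ℕ}

theorem smul_prefix_smul (g : TreeAut d) {v w : List (Fin d)} : g • v <+: g • w ↔ v <+: w :=
  g.map_rel_iff

theorem length_le_length_smul (g : TreeAut d) (v : List (Fin d)) : v.length ≤ (g • v).length := by
  induction v using List.reverseRecOn with
  | nil => simp
  | append_singleton v x ih =>
    have h1 : g • v <+: g • (v ++ [x]) := g.smul_prefix_smul.2 (List.prefix_append _ _)
    have h2 : (g • v).length ≠ (g • (v ++ [x])).length := fun h => by
      have h3 : v = v ++ [x] := MulAction.injective g (h1.eq_of_length h)
      simpa using congrArg List.length h3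
    have h4 := h1.length_le
    simp only [List.length_append, List.length_singleton]
    omega

/-- Tree automorphisms preserve the levels. -/
theorem length_smul (g : TreeAut d) (v : List (Fin d)) : (g • v).length = v.length := by
  refine le_antisymm ?_ (g.length_le_length_smul v)
  simpa using g⁻¹.length_le_length_smul (g • v)

/-- If `g` fixes the vertex `v`, it maps the subtree `T_v` to itself. -/
theorem append_drop_smul {g : TreeAut d} {v : List (Fin d)} (hg : g • v = v) (w : List (Fin d)) :
    v ++ (g • (v ++ w)).drop v.length = g • (v ++ w) := by
  have h : v <+: g • (v ++ w) := by
    have := g.smul_prefix_smul.2 (List.prefix_append v w)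
    rwa [hg] at this
  exact List.prefix_iff_eq_append.1 h

/-- The homomorphism `ψ_v : Stab(v) → Aut(T)`, `g ↦ g|_{T_v}`, where the subtree `T_v` is identified
with `T` by `v ++ w ↔ w`. -/
def restrict (v : List (Fin d)) : MulAction.stabilizer (TreeAut d) v →* TreeAut d where
  toFun g :=
    { toFun := fun w => (g.1 • (v ++ w)).drop v.length
      invFun := fun w => (g.1⁻¹ • (v ++ w)).drop v.length
      left_inv := fun w => by
        change (g.1⁻¹ • (v ++ (g.1 • (v ++ w)).drop v.length)).drop v.length = w
        rw [append_drop_smul g.2, inv_smul_smul, List.drop_left]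
      right_inv := fun w => by
        change (g.1 • (v ++ (g.1⁻¹ • (v ++ w)).drop v.length)).drop v.length = w
        rw [append_drop_smul (g := g.1⁻¹) (g⁻¹).2, smul_inv_smul, List.drop_left]
      map_rel_iff' := fun {a b} => by
        change (g.1 • (v ++ a)).drop v.length <+: (g.1 • (v ++ b)).drop v.length ↔ a <+: b
        rw [← List.prefix_append_right_inj v, append_drop_smul g.2, append_drop_smul g.2,
          smul_prefix_smul, List.prefix_append_right_inj] }
  map_one' := by
    ext1 w
    change ((1 : TreeAut d) • (v ++ w)).drop v.length = w
    simp
  map_mul' g h := by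
    ext1 w
    change ((g.1 * h.1) • (v ++ w)).drop v.length
      = (g.1 • (v ++ (h.1 • (v ++ w)).drop v.length)).drop v.length
    rw [append_drop_smul h.2, mul_smul]

/-- The defining property of the restriction: `g (v w) = v (g|_{T_v} w)`. -/
theorem append_restrict_smul (v : List (Fin d)) (g : MulAction.stabilizer (TreeAut d) v)
    (w : List (Fin d)) : v ++ restrict v g • w = g.1 • (v ++ w) :=
  append_drop_smul g.2 w

/-- The stabilizer of level `n` in `Aut(T)`: the intersection of the stabilizers of all vertices of
level `n`. -/
def levelStabilizer (d n : ℕ) : Subgroup (TreeAut d) :=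
  ⨅ v : {v : List (Fin d) // v.length = n}, MulAction.stabilizer (TreeAut d) v.1

/-- The homomorphism `ψ_1 : Stab(1) → Aut(T)^d`, `g ↦ (g|_{T_{v_1}}, …, g|_{T_{v_d}})`, where
`v_1, …, v_d` are the vertices of the first level. -/
def psiOne (d : ℕ) : levelStabilizer d 1 →* (Fin d → TreeAut d) :=
  MonoidHom.pi fun i =>
    (restrict [i]).comp
      (Subgroup.inclusion (iInf_le (fun v : {v : List (Fin d) // v.length = 1} =>
        MulAction.stabilizer (TreeAut d) v.1) ⟨[i], rfl⟩))

/-- `G` acts transitively on every level of `T`. -/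
def SphericallyTransitive (G : Subgroup (TreeAut d)) : Prop :=
  ∀ v w : List (Fin d), v.length = w.length → ∃ g ∈ G, g • v = w

/-- `G` is self-similar: `ψ_v(Stab_G(v)) = G` for every vertex `v`. -/
def SelfSimilar (G : Subgroup (TreeAut d)) : Prop :=
  ∀ v : List (Fin d), (G.subgroupOf (MulAction.stabilizer (TreeAut d) v)).map (restrict v) = G

/-- `G` is regular branch over its subgroup `K`: it is spherically transitive and self-similar, `K`
has finite index in `G`, and `K^d` is contained in `ψ_1(K ∩ Stab_G(1))` as a subgroup of finite
index. -/
structure IsRegularBranchOver (G K : Subgroup (TreeAut d)) : Prop where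
  sphericallyTransitive : SphericallyTransitive G
  selfSimilar : SelfSimilar G
  le : K ≤ G
  finiteIndex : K.IsFiniteRelIndex G
  pi_le : Subgroup.pi Set.univ (fun _ : Fin d => K) ≤
    (K.subgroupOf (levelStabilizer d 1)).map (psiOne d)
  pi_finiteIndex : (Subgroup.pi Set.univ (fun _ : Fin d => K)).IsFiniteRelIndex
    ((K.subgroupOf (levelStabilizer d 1)).map (psiOne d))

/-- `G` is a regular branch group. -/
def IsRegularBranch (G : Subgroup (TreeAut d)) : Prop :=
  ∃ K : Subgroup (TreeAut d), IsRegularBranchOver G K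

end TreeAut

/-- A point of the boundary `∂T` of the `d`-regular rooted tree `T`: an infinite ray that starts at
the root, given by its vertex on each level. -/
@[ext]
structure TreeBoundary (d : ℕ) where
  /-- The vertex of the ray on level `n`. -/
  vertex : ℕ → List (Fin d)
  length_vertex : ∀ n, (vertex n).length = n
  vertex_prefix : ∀ n, vertex n <+: vertex (n + 1)

/-- The action of `Aut(T)` on `∂T`. -/
instance (d : ℕ) : MulAction (TreeAut d) (TreeBoundary d) where
  smul g ξ :=
    { vertex := fun n => g • ξ.vertex n
      length_vertex := fun n => by rw [TreeAut.length_smul, ξ.length_vertex]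
      vertex_prefix := fun n => g.smul_prefix_smul.2 (ξ.vertex_prefix n) }
  one_smul _ := rfl
  mul_smul _ _ _ := rfl

/-- A weakly maximal subgroup: a maximal element among the subgroups of infinite index. -/
def IsWeaklyMaximal {G : Type*} [Group G] (W : Subgroup G) : Prop :=
  Maximal (fun H : Subgroup G => ¬ H.FiniteIndex) W

/-- Automorphism equivalence of subgroups of `G`: `H` and `L` are equivalent iff some automorphism
of `G` maps `H` onto `L`. -/
def autEquivalence (G : Type*) [Group G] : Setoid (Subgroup G) where
  r H L := ∃ φ : G ≃* G, H.map φ.toMonoidHom = L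
  iseqv :=
    { refl := fun H => ⟨MulEquiv.refl G, H.map_id⟩
      symm := by
        rintro H L ⟨φ, rfl⟩
        refine ⟨φ.symm, ?_⟩
        rw [Subgroup.map_map]
        convert H.map_id
        ext x
        simp
      trans := by
        rintro H L M ⟨φ, rfl⟩ ⟨χ, rfl⟩
        refine ⟨φ.trans χ, ?_⟩
        rw [Subgroup.map_map]
        rfl }

/-- The type of automorphism equivalence classes of subgroups of `G`. -/
abbrev AutClass (G : Type*) [Group G] : Type _ := Quotient (autEquivalence G)

/-- The automorphism equivalence class of a subgroup. -/
def autClass {G : Type*} [Group G] (H : Subgroup G) : AutClass G :=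
  Quotient.mk (autEquivalence G) H

/-- The parabolic subgroups of `G ≤ Aut(T)`: the stabilizers in `G` of the boundary points. -/
def IsParabolic {d : ℕ} {G : Subgroup (TreeAut d)} (P : Subgroup G) : Prop :=
  ∃ ξ : TreeBoundary d, P = MulAction.stabilizer G ξ

/-! To a ray `ξ` attach the subgroup `rayOrbitSubgroup Q ξ`, generated by `Q` and the rigid
stabilizers of all vertices off the orbit `Qξ`. It preserves the finite set `Qξ`, whereas ray
stabilizers have infinite index in `G`; hence it has infinite index. As `G` is finitely generated,
Zorn's lemma puts it inside a weakly maximal subgroup `W ξ`.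

If `ξ` and `η` lie in different `Q`-orbits, then on a deep level every vertex avoids one of the two
orbits. A subgroup containing both ray subgroups then contains all rigid stabilizers of that level,
so it has finite index by branching (`finiteIndex_iSup_rist`). Thus `ξ ↦ W ξ` has finite fibres.
Since `Aut(G)` is countable and the boundary is not, the `W ξ` fall into uncountably many classes.

No `W ξ` is equivalent to a parabolic subgroup. The group structure of `G` remembers the boundary
well enough that an automorphism sends each parabolic subgroup into a parabolic one
(`exists_map_stabilizer_le`), while `W ξ` contains `Q`, which fixes no ray. The key is a double
commutator argument in the style of Rubin (`eq_of_rist_map_smul_ne`). -/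

namespace TreeAut

/-! ### Rigid stabilizers and level stabilizers in `Aut(T)` -/

variable {d : ℕ}

/-- The rigid stabilizer of the vertex `v` in `Aut(T)`: the automorphisms that fix every vertex
outside of `T_v`. -/
def rigidStabilizer (v : List (Fin d)) : Subgroup (TreeAut d) where
  carrier := {g | ∀ w, ¬ v <+: w → g • w = w}
  one_mem' w _ := one_smul _ w
  mul_mem' {a b} ha hb w hw := by rw [mul_smul, hb w hw, ha w hw]
  inv_mem' {a} ha w hw := by rw [inv_smul_eq_iff, ha w hw]

theorem smul_nil (g : TreeAut d) : g • ([] : List (Fin d)) = [] := by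
  have := g.length_smul []
  exact List.length_eq_zero_iff.1 this

theorem rigidStabilizer_nil : rigidStabilizer ([] : List (Fin d)) = ⊤ := by
  rw [eq_top_iff]
  intro g _ w hw
  exact absurd (List.nil_prefix) hw

theorem smul_eq_self_of_mem_rigidStabilizer {v : List (Fin d)} {g : TreeAut d}
    (hg : g ∈ rigidStabilizer v) {w : List (Fin d)} (hw : w.length ≤ v.length) : g • w = w := by
  by_cases h : v <+: w
  · have hvw : v = w := h.eq_of_length (le_antisymm h.length_le hw)
    subst hvw
    by_contra hne
    -- If `g` moved `v`, then `g • v`, on the same level, would lie outside `T_v` and so be fixed.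
    have h1 : g • g • v = g • v := hg _ fun h2 =>
      hne (h2.eq_of_length (g.length_smul v).symm).symm
    exact hne (MulAction.injective g h1)
  · exact hg w h

theorem rigidStabilizer_mono {v w : List (Fin d)} (h : v <+: w) :
    rigidStabilizer w ≤ rigidStabilizer v :=
  fun _ hg u hu => hg u fun h' => hu (h.trans h')

theorem conj_mem_rigidStabilizer (g : TreeAut d) {v : List (Fin d)} {r : TreeAut d}
    (hr : r ∈ rigidStabilizer v) : g * r * g⁻¹ ∈ rigidStabilizer (g • v) := by
  intro w hw
  have h : r • g⁻¹ • w = g⁻¹ • w := hr _ fun h => hw (by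
    have := g.smul_prefix_smul.2 h
    rwa [smul_inv_smul] at this)
  rw [mul_smul, mul_smul, h, smul_inv_smul]

theorem not_prefix_of_ne {v v' w : List (Fin d)} (hl : v.length = v'.length) (hne : v ≠ v')
    (h : v <+: w) : ¬ v' <+: w := fun h' =>
  hne ((List.prefix_of_prefix_length_le h h' hl.le).eq_of_length hl)

theorem ext_smul {g h : TreeAut d} (H : ∀ w : List (Fin d), g • w = h • w) : g = h :=
  RelIso.ext H

theorem eq_one_of_mem_rigidStabilizer {v v' : List (Fin d)} (hl : v.length = v'.length)
    (hne : v ≠ v') {g : TreeAut d} (h : g ∈ rigidStabilizer v) (h' : g ∈ rigidStabilizer v') :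
    g = 1 := by
  refine ext_smul fun w => ?_
  rw [one_smul]
  by_cases hw : v <+: w
  · exact h' w (not_prefix_of_ne hl hne hw)
  · exact h w hw

theorem commute_of_mem_rigidStabilizer {v v' : List (Fin d)} (hl : v.length = v'.length)
    (hne : v ≠ v') {x y : TreeAut d} (hx : x ∈ rigidStabilizer v) (hy : y ∈ rigidStabilizer v') :
    x * y = y * x := by
  have key : ∀ {v v' : List (Fin d)} {x y : TreeAut d}, v.length = v'.length → v ≠ v' →
      x ∈ rigidStabilizer v → y ∈ rigidStabilizer v' → ∀ w, v <+: w → x • y • w = y • x • w := by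
    intro v v' x y hl hne hx hy w hw
    have h1 : v <+: x • w := by
      have := x.smul_prefix_smul.2 hw
      rwa [smul_eq_self_of_mem_rigidStabilizer hx le_rfl] at this
    rw [hy w (not_prefix_of_ne hl hne hw), hy _ (not_prefix_of_ne hl hne h1)]
  refine ext_smul fun w => ?_
  rw [mul_smul, mul_smul]
  by_cases hw : v <+: w
  · exact key hl hne hx hy w hw
  by_cases hw' : v' <+: w
  · exact (key hl.symm hne.symm hy hx w hw').symm
  rw [hx w hw, hy w hw', hx w hw]

theorem mem_levelStabilizer {n : ℕ} {g : TreeAut d} :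
    g ∈ levelStabilizer d n ↔ ∀ v : List (Fin d), v.length = n → g • v = v := by
  simp [levelStabilizer, Subgroup.mem_iInf, MulAction.mem_stabilizer_iff]

instance finiteIndex_levelStabilizer (n : ℕ) : (levelStabilizer d n).FiniteIndex := by
  have : Finite {v : List (Fin d) // v.length = n} := List.finite_length_eq (Fin d) n
  refine Subgroup.finiteIndex_iInf fun v => ?_
  have : Finite (MulAction.orbit (TreeAut d) v.1) := by
    refine Set.Finite.subset (List.finite_length_eq (Fin d) n) ?_
    rintro _ ⟨g, rfl⟩
    exact (g.length_smul v.1).trans v.2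
  have : Finite (TreeAut d ⧸ MulAction.stabilizer (TreeAut d) v.1) :=
    Finite.of_equiv _ (MulAction.orbitEquivQuotientStabilizer (TreeAut d) v.1)
  exact Subgroup.finiteIndex_of_finite_quotient

theorem psiOne_apply_smul (g : levelStabilizer d 1) (i : Fin d) (w : List (Fin d)) :
    i :: psiOne d g i • w = g.1 • (i :: w) :=
  append_restrict_smul [i] (Subgroup.inclusion (iInf_le (fun v : {v : List (Fin d) //
    v.length = 1} => MulAction.stabilizer (TreeAut d) v.1) ⟨[i], rfl⟩) g) w

theorem psiOne_injective : Function.Injective (psiOne d) := by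
  intro g h hgh
  refine Subtype.ext (ext_smul fun w => ?_)
  cases w with
  | nil => rw [smul_nil, smul_nil]
  | cons i w => rw [← psiOne_apply_smul, ← psiOne_apply_smul, hgh]

theorem mem_rigidStabilizer_cons {g : levelStabilizer d 1} {i : Fin d} {v : List (Fin d)}
    {r : TreeAut d} (hr : r ∈ rigidStabilizer v) (hg : psiOne d g = Pi.mulSingle i r) :
    g.1 ∈ rigidStabilizer (i :: v) := by
  intro w hw
  cases w with
  | nil => exact smul_nil _
  | cons j w =>
    rw [← psiOne_apply_smul, hg]
    by_cases hij : j = i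
    · subst hij
      rw [Pi.mulSingle_eq_same, hr w fun h => hw (List.cons_prefix_cons.2 ⟨rfl, h⟩)]
    · rw [Pi.mulSingle_eq_of_ne hij, one_smul]

/-! ### Branching: rigid stabilizers of a level generate a finite index subgroup -/

namespace IsRegularBranchOver

variable {G K : Subgroup (TreeAut d)}

theorem exists_psiOne_eq_mulSingle (h : IsRegularBranchOver G K) (i : Fin d) {r : TreeAut d}
    (hr : r ∈ K) : ∃ g : levelStabilizer d 1, g.1 ∈ K ∧ psiOne d g = Pi.mulSingle i r := by
  have : Pi.mulSingle i r ∈ Subgroup.pi Set.univ (fun _ : Fin d => K) := by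
    intro j _
    by_cases hij : j = i
    · subst hij; simpa using hr
    · simp [Pi.mulSingle_eq_of_ne hij]
  obtain ⟨g, hg, hgr⟩ := h.pi_le this
  exact ⟨g, hg, hgr⟩

/-- Every element of the branching subgroup `K`, transported to the subtree `T_v`, lies in `K`. -/
theorem exists_mem_rigidStabilizer_append_smul (h : IsRegularBranchOver G K) (v : List (Fin d))
    {k : TreeAut d} (hk : k ∈ K) :
    ∃ g ∈ K, g ∈ rigidStabilizer v ∧ ∀ w, g • (v ++ w) = v ++ k • w := by
  induction v with
  | nil => exact ⟨k, hk, by rw [rigidStabilizer_nil]; trivial, fun w => rfl⟩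
  | cons i v ih =>
    obtain ⟨r, hrK, hr, hrw⟩ := ih
    obtain ⟨g, hgK, hg⟩ := h.exists_psiOne_eq_mulSingle i hrK
    refine ⟨g, hgK, mem_rigidStabilizer_cons hr hg, fun w => ?_⟩
    rw [List.cons_append, ← psiOne_apply_smul, hg, Pi.mulSingle_eq_same, hrw, List.cons_append]

/-- The product of the rigid stabilizers in `K` of the vertices of level `n` has finite index
in `K`. -/
theorem relIndex_iSup_rigidStabilizer_ne_zero (h : IsRegularBranchOver G K) (n : ℕ) :
    (⨆ v : {v : List (Fin d) // v.length = n}, rigidStabilizer v.1 ⊓ K).relIndex K ≠ 0 := by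
  induction n with
  | zero =>
    have hle : K ≤ ⨆ v : {v : List (Fin d) // v.length = 0}, rigidStabilizer v.1 ⊓ K := by
      refine le_iSup_of_le ⟨[], rfl⟩ ?_
      simp [rigidStabilizer_nil]
    rw [Subgroup.relIndex_eq_one.2 hle]
    exact one_ne_zero
  | succ n ih =>
    set R := ⨆ v : {v : List (Fin d) // v.length = n}, rigidStabilizer v.1 ⊓ K with hR
    set R' := ⨆ v : {v : List (Fin d) // v.length = n + 1}, rigidStabilizer v.1 ⊓ K with hR'
    -- Branching puts a level `n` rigid stabilizer, placed in coordinate `i`, below the first level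
    -- vertex `i`. So `R^d` lies in the image of `R'`, and the finite indices of `R^d` in `K^d` and
    -- of `K^d` in `ψ_1(K ∩ Stab(1))` multiply.
    have h1 : Subgroup.pi Set.univ (fun _ : Fin d => R) ≤
        (R'.subgroupOf (levelStabilizer d 1)).map (psiOne d) := by
      refine Subgroup.pi_le_iff.2 fun i => ?_
      rw [hR, Subgroup.map_iSup]
      refine iSup_le fun v => ?_
      rintro _ ⟨r, ⟨hrv, hrK⟩, rfl⟩
      obtain ⟨g, hgK, hg⟩ := h.exists_psiOne_eq_mulSingle i hrK
      refine ⟨g, ?_, hg⟩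
      have hmem : g.1 ∈ R' := Subgroup.mem_iSup_of_mem ⟨i :: v.1, by simp [v.2]⟩
        ⟨mem_rigidStabilizer_cons hrv hg, hgK⟩
      exact hmem
    have h2 : (Subgroup.pi Set.univ (fun _ : Fin d => R)).relIndex
        (Subgroup.pi Set.univ (fun _ : Fin d => K)) ≠ 0 := by
      have : Subgroup.pi Set.univ (fun _ : Fin d => R) =
          ⨅ i : Fin d, R.comap (Pi.evalMonoidHom (fun _ => TreeAut d) i) := by
        ext f
        simp [Subgroup.mem_pi, Subgroup.mem_iInf]
      rw [this]
      refine Subgroup.relIndex_iInf_ne_zero fun i => ?_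
      rw [Subgroup.relIndex_comap]
      refine fun h0 => ih (Subgroup.relIndex_eq_zero_of_le_right ?_ h0)
      rintro _ ⟨f, hf, rfl⟩
      exact hf i trivial
    have h3 := Subgroup.relIndex_ne_zero_trans h2 h.pi_finiteIndex.relIndex_ne_zero
    have h4 : ((R'.subgroupOf (levelStabilizer d 1)).map (psiOne d)).relIndex
        ((K.subgroupOf (levelStabilizer d 1)).map (psiOne d)) ≠ 0 :=
      fun h0 => h3 (Subgroup.relIndex_eq_zero_of_le_left h1 h0)
    rw [Subgroup.relIndex_map_map_of_injective _ _ psiOne_injective, Subgroup.subgroupOf,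
      Subgroup.relIndex_comap] at h4
    simp only [Subgroup.subgroupOf_map_subtype] at h4
    refine Subgroup.relIndex_ne_zero_trans h4 ?_
    rw [Subgroup.inf_relIndex_left]
    intro h0
    exact (Subgroup.FiniteIndex.index_ne_zero (H := levelStabilizer d 1))
      (Subgroup.index_eq_zero_of_relIndex_eq_zero h0)

end IsRegularBranchOver

end TreeAut

/-! ### Rays and the uncountability of the boundary -/

namespace TreeBoundary

variable {d : ℕ}

theorem vertex_prefix_of_le (ξ : TreeBoundary d) {m n : ℕ} (h : m ≤ n) :
    ξ.vertex m <+: ξ.vertex n := by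
  induction n, h using Nat.le_induction with
  | base => exact List.prefix_rfl
  | succ n _ ih => exact ih.trans (ξ.vertex_prefix n)

/-- Rays that differ on some level differ on all deeper levels. -/
theorem vertex_ne_of_le {ξ η : TreeBoundary d} {m n : ℕ} (h : m ≤ n)
    (hne : ξ.vertex m ≠ η.vertex m) : ξ.vertex n ≠ η.vertex n := by
  intro heq
  have h1 := ξ.vertex_prefix_of_le h
  rw [heq] at h1
  exact hne ((List.prefix_of_prefix_length_le h1 (η.vertex_prefix_of_le h)
    (by simp [length_vertex])).eq_of_length (by simp [length_vertex]))

theorem exists_vertex_ne {ξ η : TreeBoundary d} (h : ξ ≠ η) : ∃ n, ξ.vertex n ≠ η.vertex n := by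
  by_contra! hcon
  exact h (TreeBoundary.ext (funext hcon))

/-- The ray whose `n`-th edge is labelled by `f n`. -/
def ofFun (f : ℕ → Fin d) : TreeBoundary d where
  vertex n := List.ofFn fun i : Fin n => f i
  length_vertex n := List.length_ofFn
  vertex_prefix n := by
    rw [List.ofFn_succ']
    simp [List.concat_eq_append]

theorem ofFun_injective : Function.Injective (ofFun (d := d)) := by
  intro f g h
  funext n
  have h1 : List.ofFn (fun i : Fin (n + 1) => f i) = List.ofFn (fun i : Fin (n + 1) => g i) :=
    congrArg (fun ξ : TreeBoundary d => ξ.vertex (n + 1)) h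
  have h2 := congrFun (List.ofFn_injective h1) (Fin.last n)
  simpa using h2

theorem not_countable (hd : 2 ≤ d) : ¬ Countable (TreeBoundary d) := by
  intro h
  have : Nontrivial (Fin d) := Fin.nontrivial_iff_two_le.2 hd
  have h1 : Countable (ℕ → Fin d) := ofFun_injective.countable
  obtain ⟨a, b, hab⟩ := exists_pair_ne (Fin d)
  classical
  have h2 : Function.Injective (fun (s : Set ℕ) (n : ℕ) => if n ∈ s then a else b) := by
    intro s t hst
    ext n
    have := congrFun hst n
    by_cases hs : n ∈ s <;> by_cases ht : n ∈ t <;> simp_all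
  have h3 : Countable (Set ℕ) := h2.countable
  obtain ⟨f, hf⟩ := exists_injective_nat (Set ℕ)
  obtain ⟨g, hg⟩ := h3.exists_injective_nat
  exact Function.cantor_injective g hg

end TreeBoundary

/-! ### Rigid stabilizers in `G` and the reconstruction of boundary points from the group -/

namespace TreeAut

variable {d : ℕ} {G K : Subgroup (TreeAut d)}

theorem SphericallyTransitive.not_finiteIndex_stabilizer (hd : 2 ≤ d)
    (hG : SphericallyTransitive G) (ξ : TreeBoundary d) :
    ¬ (MulAction.stabilizer G ξ).FiniteIndex := by
  intro hfin
  -- Level `N` serves as a contradiction: the stabilizer of its vertex on `ξ` has index `d ^ N > N`,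
  -- yet contains the stabilizer of `ξ`.
  set N := (MulAction.stabilizer G ξ).index with hN
  have hle : MulAction.stabilizer G ξ ≤ MulAction.stabilizer G (ξ.vertex N) := by
    intro g hg
    have h1 : g • ξ = ξ := hg
    exact congrArg (fun η : TreeBoundary d => η.vertex N) h1
  have h1 := Subgroup.index_antitone hle
  have horb : MulAction.orbit G (ξ.vertex N) = {v : List (Fin d) | v.length = N} := by
    ext v
    constructor
    · rintro ⟨g, rfl⟩
      exact (length_smul g.1 _).trans (ξ.length_vertex N)
    · intro hv
      obtain ⟨g, hg, hgv⟩ := hG (ξ.vertex N) v ((ξ.length_vertex N).trans (Eq.symm hv))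
      exact ⟨⟨g, hg⟩, hgv⟩
  have hcard : {v : List (Fin d) | v.length = N}.ncard = d ^ N := by
    have : Nat.card (List.Vector (Fin d) N) = d ^ N := by
      rw [Nat.card_eq_fintype_card, card_vector, Fintype.card_fin]
    exact this
  rw [MulAction.index_stabilizer, horb, hcard] at h1
  have h2 : N < 2 ^ N := Nat.lt_two_pow_self
  have h3 : 2 ^ N ≤ d ^ N := Nat.pow_le_pow_left hd N
  omega

/-- The rigid stabilizer in `G` of the vertex `v`. -/
def rist (G : Subgroup (TreeAut d)) (v : List (Fin d)) : Subgroup G :=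
  (rigidStabilizer v).subgroupOf G

theorem conj_mem_rist (g : G) {v : List (Fin d)} {r : G} (hr : r ∈ rist G v) :
    g * r * g⁻¹ ∈ rist G (g.1 • v) :=
  conj_mem_rigidStabilizer g.1 hr

theorem eq_one_of_mem_rist {v v' : List (Fin d)} (hl : v.length = v'.length)
    (hne : v ≠ v') {g : G} (h : g ∈ rist G v) (h' : g ∈ rist G v') : g = 1 :=
  Subtype.ext (eq_one_of_mem_rigidStabilizer hl hne h h')

theorem commute_of_mem_rist {v v' : List (Fin d)} (hl : v.length = v'.length)
    (hne : v ≠ v') {x y : G} (hx : x ∈ rist G v) (hy : y ∈ rist G v') : x * y = y * x :=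
  Subtype.ext (commute_of_mem_rigidStabilizer hl hne hx hy)

namespace IsRegularBranchOver

theorem finiteIndex_iSup_rist (h : IsRegularBranchOver G K) (n : ℕ) :
    (⨆ v : {v : List (Fin d) // v.length = n}, rist G v.1).FiniteIndex := by
  have h1 := Subgroup.relIndex_ne_zero_trans (h.relIndex_iSup_rigidStabilizer_ne_zero n)
    h.finiteIndex.relIndex_ne_zero
  have hle : (⨆ v : {v : List (Fin d) // v.length = n}, rigidStabilizer v.1 ⊓ K) ≤
      (⨆ v : {v : List (Fin d) // v.length = n}, rist G v.1).map G.subtype := by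
    rw [Subgroup.map_iSup]
    refine iSup_mono fun v => ?_
    rintro g ⟨hg, hgK⟩
    exact ⟨⟨g, h.le hgK⟩, hg, rfl⟩
  have h2 : ((⨆ v : {v : List (Fin d) // v.length = n}, rist G v.1).map G.subtype).relIndex
      G ≠ 0 := fun h0 => h1 (Subgroup.relIndex_eq_zero_of_le_left hle h0)
  refine ⟨fun h0 => h2 ?_⟩
  rw [Subgroup.relIndex, Subgroup.subgroupOf,
    Subgroup.comap_map_eq_self_of_injective G.subtype_injective]
  exact h0

theorem infinite_group (hd : 2 ≤ d) (h : IsRegularBranchOver G K) : Infinite G := by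
  by_contra hfin
  rw [not_infinite_iff_finite] at hfin
  exact h.sphericallyTransitive.not_finiteIndex_stabilizer hd
    (TreeBoundary.ofFun fun _ => ⟨0, by omega⟩) inferInstance

theorem infinite_branching (hd : 2 ≤ d) (h : IsRegularBranchOver G K) : Infinite K := by
  by_contra hfin
  rw [not_infinite_iff_finite] at hfin
  have hinf := h.infinite_group hd
  have h1 : (⊥ : Subgroup (TreeAut d)).relIndex K ≠ 0 := by
    rw [Subgroup.relIndex_bot_left]
    exact Nat.card_pos.ne'
  have h2 := Subgroup.relIndex_ne_zero_trans h1 h.finiteIndex.relIndex_ne_zero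
  rw [Subgroup.relIndex_bot_left] at h2
  exact h2 Nat.card_eq_zero_of_infinite

theorem infinite_rist (hd : 2 ≤ d) (h : IsRegularBranchOver G K) (v : List (Fin d)) : Infinite (rist G v) := by
  have := h.infinite_branching hd
  choose f hfK hfr hf using fun k : K => h.exists_mem_rigidStabilizer_append_smul v k.2
  refine Infinite.of_injective (fun k : K => (⟨⟨f k, h.le (hfK k)⟩, hfr k⟩ : rist G v)) ?_
  intro k l hkl
  have hkl' : f k = f l := congrArg (fun x : rist G v => x.1.1) hkl
  refine Subtype.ext (ext_smul fun w => ?_)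
  refine List.append_cancel_left (as := v) ?_
  rw [← hf, ← hf, hkl']

/-- Rigid stabilizers meet finite index subgroups nontrivially. -/
theorem exists_mem_rist_ne_one (hd : 2 ≤ d) (h : IsRegularBranchOver G K) (B : Subgroup G) [B.FiniteIndex]
    (v : List (Fin d)) : ∃ g ∈ B, g ∈ rist G v ∧ g ≠ 1 := by
  have hinf := h.infinite_rist hd v
  by_contra! hcon
  have hbot : B.subgroupOf (rist G v) = ⊥ := by
    rw [eq_bot_iff]
    intro g hg
    exact Subtype.ext (hcon g.1 hg g.2)
  have h1 : (B.subgroupOf (rist G v)).FiniteIndex := inferInstance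
  rw [hbot] at h1
  have h2 := h1.index_ne_zero
  rw [Subgroup.index_bot] at h2
  exact h2 Nat.card_eq_zero_of_infinite

/-- Finite index subgroups of rigid stabilizers are not abelian. -/
theorem exists_mem_rist_not_commute (hd : 2 ≤ d) (h : IsRegularBranchOver G K) (B : Subgroup G)
    [B.FiniteIndex] (v : List (Fin d)) :
    ∃ x ∈ B, ∃ y ∈ B, x ∈ rist G v ∧ y ∈ rist G v ∧ x * y ≠ y * x := by
  obtain ⟨x, hxB, hx, hx1⟩ := h.exists_mem_rist_ne_one hd B v
  obtain ⟨z, hz⟩ : ∃ z : List (Fin d), x.1 • z ≠ z := by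
    by_contra! hcon
    exact hx1 (Subtype.ext (ext_smul fun w => by rw [hcon w]; exact (one_smul _ w).symm))
  have hvz : v <+: z := by
    by_contra hvz
    exact hz (hx z hvz)
  obtain ⟨y, hyB, hy, hy1⟩ := h.exists_mem_rist_ne_one hd B z
  refine ⟨x, hxB, y, hyB, hx, rigidStabilizer_mono hvz hy, fun hcomm => hy1 ?_⟩
  -- If `x` and `y` commuted, `y` would be supported both below `z` and below `x • z ≠ z`.
  have h1 := conj_mem_rist x hy
  rw [hcomm, mul_inv_cancel_right] at h1
  exact eq_one_of_mem_rist (length_smul x.1 z) hz h1 hy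

/-- No automorphism of `G` maps all rigid stabilizers of level `n` into the stabilizer of a single
boundary point. -/
theorem exists_rist_map_smul_ne (hd : 2 ≤ d) (h : IsRegularBranchOver G K) (ψ : G ≃* G) (ξ : TreeBoundary d)
    (n : ℕ) : ∃ w : List (Fin d), w.length = n ∧ ∃ r ∈ rist G w, ψ r • ξ ≠ ξ := by
  by_contra! hcon
  obtain ⟨r, -, hr, hr1⟩ := h.exists_mem_rist_ne_one hd ⊤ (List.replicate n (⟨0, by omega⟩ : Fin d))
  refine hr1 (ψ.injective ?_)
  rw [map_one]
  refine Subtype.ext (ext_smul fun u => ?_)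
  -- All conjugates of `r` lie in rigid stabilizers of level `n`, so every conjugate of `ψ r` fixes
  -- `ξ`. Hence `ψ r` fixes every translate of `ξ`, and these pass through all vertices `u`.
  obtain ⟨g, hgG, hg⟩ := h.sphericallyTransitive (ξ.vertex u.length) u (ξ.length_vertex _)
  set g' : G := ⟨g, hgG⟩ with hg'
  have h1 := hcon _ (by rw [length_smul, List.length_replicate]) _
    (conj_mem_rist (ψ.symm g'⁻¹) hr)
  simp only [map_mul, map_inv, ψ.apply_symm_apply, inv_inv, mul_smul, inv_smul_eq_iff] at h1
  have h2 := congrArg (fun η : TreeBoundary d => η.vertex u.length) h1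
  have h3 : (ψ r).1 • g • ξ.vertex u.length = g • ξ.vertex u.length := h2
  rw [hg] at h3
  rw [h3]
  exact (one_smul _ u).symm

/-- Distinct rigid stabilizers of the same level have images with disjoint supports in `∂T` under
every automorphism of `G`. -/
theorem eq_of_rist_map_smul_ne (hd : 2 ≤ d) (h : IsRegularBranchOver G K) (ψ : G ≃* G) {ξ : TreeBoundary d}
    {w w' : List (Fin d)} (hl : w.length = w'.length) {r r' : G} (hr : r ∈ rist G w)
    (hr' : r' ∈ rist G w') (hrξ : ψ r • ξ ≠ ξ) (hrξ' : ψ r' • ξ ≠ ξ) : w = w' := by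
  by_contra hne
  obtain ⟨m, hm⟩ := TreeBoundary.exists_vertex_ne hrξ
  obtain ⟨m', hm'⟩ := TreeBoundary.exists_vertex_ne hrξ'
  have hu := TreeBoundary.vertex_ne_of_le (le_max_left m m') hm
  have hu' := TreeBoundary.vertex_ne_of_le (le_max_right m m') hm'
  -- This vertex is deep enough on `ξ` to be moved by both `ψ r` and `ψ r'`.
  set u := ξ.vertex (max m m') with hu_def
  set S : Subgroup G := (levelStabilizer d w.length).subgroupOf G with hS
  have hSfin : S.FiniteIndex := inferInstance
  have hBfin : (S.comap ψ.symm.toMonoidHom).FiniteIndex :=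
    ⟨by rw [S.index_comap_of_surjective ψ.symm.surjective]; exact hSfin.index_ne_zero⟩
  obtain ⟨x, hxB, y, hyB, hx, hy, hxy⟩ :=
    h.exists_mem_rist_not_commute hd (S.comap ψ.symm.toMonoidHom) u
  -- The element `x⁻¹ * y * x * y⁻¹` is the double commutator of `ψ r`, `x` and `y`. Pulled back by
  -- `ψ`, it involves `r` and conjugation by elements of `S`, which normalize the rigid stabilizer
  -- of `w`. It does not depend on `r`, so it is confined to both `w` and `w'` and must be trivial.
  have key : ∀ {w : List (Fin d)} {r : G}, (∀ s ∈ S, s.1 • w = w) → r ∈ rist G w →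
      (ψ r).1 • u ≠ u → ψ.symm (x⁻¹ * y * x * y⁻¹) ∈ rist G w := by
    intro w r hSw hr hru
    have hconj : ∀ s ∈ S, ∀ t ∈ rist G w, s * t * s⁻¹ ∈ rist G w := by
      intro s hs t ht
      have := conj_mem_rist s ht
      rwa [hSw s hs] at this
    have hc : r * (ψ.symm x * r⁻¹ * (ψ.symm x)⁻¹) ∈ rist G w :=
      mul_mem hr (hconj _ hxB _ (inv_mem hr))
    have hc2 := mul_mem hc (hconj _ hyB _ (inv_mem hc))
    have hcomm : ∀ z ∈ rist G u, (ψ r * x * (ψ r)⁻¹) * z = z * (ψ r * x * (ψ r)⁻¹) :=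
      fun z hz => commute_of_mem_rist (length_smul (ψ r).1 u) hru (conj_mem_rist (ψ r) hx) hz
    -- The conjugate of `x` by `ψ r` lives below another vertex of the level of `u`, so it commutes
    -- with `x⁻¹ * y * x` and cancels.
    have heq : x⁻¹ * y * x * y⁻¹ =
        (ψ r * x * (ψ r)⁻¹ * x⁻¹) * y * (ψ r * x * (ψ r)⁻¹ * x⁻¹)⁻¹ * y⁻¹ := by
      have h1 := hcomm _ (mul_mem (mul_mem (inv_mem hx) hy) hx)
      set q := ψ r * x * (ψ r)⁻¹ with hq
      calc x⁻¹ * y * x * y⁻¹ = (x⁻¹ * y * x) * q * q⁻¹ * y⁻¹ := by group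
        _ = q * (x⁻¹ * y * x) * q⁻¹ * y⁻¹ := by rw [h1]
        _ = _ := by group
    have hfinal : ψ.symm (x⁻¹ * y * x * y⁻¹) =
        r * (ψ.symm x * r⁻¹ * (ψ.symm x)⁻¹) * (ψ.symm y *
          (r * (ψ.symm x * r⁻¹ * (ψ.symm x)⁻¹))⁻¹ * (ψ.symm y)⁻¹) := by
      rw [heq]
      simp only [map_mul, map_inv, ψ.symm_apply_apply]
      group
    rw [hfinal]
    exact hc2
  have h1 := key (fun s hs => mem_levelStabilizer.1 hs _ rfl) hr hu
  have h2 := key (fun s hs => mem_levelStabilizer.1 hs _ hl.symm) hr' hu'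
  have h3 := eq_one_of_mem_rist hl hne h1 h2
  rw [map_eq_one_iff _ ψ.symm.injective] at h3
  refine hxy ?_
  have h4 : y * x = x * y := by
    calc y * x = x * (x⁻¹ * y * x * y⁻¹) * y := by group
      _ = x * y := by rw [h3, mul_one]
  exact h4.symm

/-- Automorphisms of `G` map parabolic subgroups into parabolic subgroups. -/
theorem exists_map_stabilizer_le (hd : 2 ≤ d) (h : IsRegularBranchOver G K) (φ : G ≃* G)
    (ξ : TreeBoundary d) :
    ∃ η : TreeBoundary d, (MulAction.stabilizer G ξ).map φ.toMonoidHom ≤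
      MulAction.stabilizer G η := by
  choose w hwl r hr hrξ using h.exists_rist_map_smul_ne hd φ.symm ξ
  -- On each level `w n` is the only vertex whose rigid stabilizer has an image under `φ.symm`
  -- moving `ξ`. Uniqueness makes the `w n` a ray.
  refine ⟨⟨w, hwl, fun n => ?_⟩, ?_⟩
  · have hl : ((w (n + 1)).take n).length = n := by simp [hwl]
    have h1 : r (n + 1) ∈ rist G ((w (n + 1)).take n) :=
      rigidStabilizer_mono (List.take_prefix _ _) (hr (n + 1))
    have h2 := h.eq_of_rist_map_smul_ne hd φ.symm (by rw [hl, hwl]) h1 (hr n) (hrξ (n + 1)) (hrξ n)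
    rw [← h2]
    exact List.take_prefix _ _
  · rintro _ ⟨p, hp, rfl⟩
    have hp' : p • ξ = ξ := hp
    refine TreeBoundary.ext (funext fun n => ?_)
    change (φ p).1 • w n = w n
    -- Conjugating `r n` by `φ p` gives a witness at `φ p • w n`: its image under `φ.symm` still
    -- moves `ξ`, because `p` fixes `ξ`. Uniqueness again applies.
    refine h.eq_of_rist_map_smul_ne hd φ.symm (length_smul _ _) (conj_mem_rist (φ p) (hr n)) (hr n)
      ?_ (hrξ n)
    rw [map_mul, map_mul, map_inv, φ.symm_apply_apply, mul_smul, mul_smul]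
    intro h0
    rw [inv_smul_eq_iff.2 hp'.symm, smul_eq_iff_eq_inv_smul, inv_smul_eq_iff.2 hp'.symm] at h0
    exact hrξ n h0

end IsRegularBranchOver

end TreeAut

/-! ### Finitely generated groups: weakly maximal subgroups and automorphisms -/

/-- In a finitely generated group every subgroup of infinite index is contained in a weakly maximal
subgroup. -/
theorem exists_le_isWeaklyMaximal {Γ : Type*} [Group Γ] [Group.FG Γ] {H : Subgroup Γ}
    (hH : ¬ H.FiniteIndex) : ∃ W : Subgroup Γ, H ≤ W ∧ IsWeaklyMaximal W := by
  refine zorn_le_nonempty₀ {H : Subgroup Γ | ¬ H.FiniteIndex} ?_ H hH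
  intro c hc hchain L hL
  refine ⟨sSup c, fun hfin => ?_, fun z hz => le_sSup hz⟩
  -- A finite index union of the chain would be finitely generated, so a single member would contain
  -- all generators and have finite index.
  have hfg : (sSup c).FG := (Group.fg_iff_subgroup_fg _).1 (Subgroup.fg_of_index_ne_zero (sSup c))
  obtain ⟨S, hS⟩ := hfg
  have hdir : DirectedOn (· ≤ ·) c := hchain.directedOn
  have key : ∀ T : Finset Γ, (T : Set Γ) ⊆ (sSup c : Subgroup Γ) → ∃ M ∈ c, (T : Set Γ) ⊆ M := by
    classical
    intro T
    induction T using Finset.induction_on with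
    | empty => exact fun _ => ⟨L, hL, by simp⟩
    | insert a T _ ih =>
      intro hT
      rw [Finset.coe_insert, Set.insert_subset_iff] at hT
      obtain ⟨M, hM, hTM⟩ := ih hT.2
      obtain ⟨M', hM', haM'⟩ := (Subgroup.mem_sSup_of_directedOn ⟨L, hL⟩ hdir).1 hT.1
      obtain ⟨N, hN, hMN, hMN'⟩ := hdir M hM M' hM'
      refine ⟨N, hN, ?_⟩
      rw [Finset.coe_insert, Set.insert_subset_iff]
      exact ⟨hMN' haM', hTM.trans hMN⟩
  obtain ⟨M, hM, hSM⟩ := key S (by rw [← hS]; exact Subgroup.subset_closure)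
  have hle : sSup c ≤ M := by
    rw [← hS]
    exact (Subgroup.closure_le M).2 hSM
  exact hc hM (Subgroup.finiteIndex_of_le hle)

/-- A finitely generated group has only countably many automorphisms. -/
theorem countable_mulEquiv_of_fg (Γ : Type*) [Group Γ] [Group.FG Γ] : Countable (Γ ≃* Γ) := by
  obtain ⟨α, hα, π, hπ⟩ := Group.fg_iff_exists_freeGroup_hom_surjective_finite.1 ‹Group.FG Γ›
  have hΓ : Countable Γ := hπ.countable
  -- An automorphism is determined by its values on finitely many generators, and the group is
  -- countable.
  refine Function.Injective.countable
    (f := fun (φ : Γ ≃* Γ) (a : α) => φ (π (FreeGroup.of a))) fun φ χ h => ?_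
  have h1 : φ.toMonoidHom.comp π = χ.toMonoidHom.comp π :=
    FreeGroup.ext_hom _ _ fun a => congrFun h a
  ext x
  obtain ⟨y, rfl⟩ := hπ x
  exact DFunLike.congr_fun h1 y

/-! ### The subgroups attached to `Q`-orbits of rays -/

namespace TreeAut

variable {d : ℕ} {G K : Subgroup (TreeAut d)}

/-- The subgroup generated by `Q` and the rigid stabilizers of all vertices that do not lie on the
`Q`-orbit of the ray `ξ`. -/
def rayOrbitSubgroup (Q : Subgroup G) (ξ : TreeBoundary d) : Subgroup G :=
  Q ⊔ ⨆ v : {v : List (Fin d) // ∀ q ∈ Q, (q • ξ).vertex v.length ≠ v}, rist G v.1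

theorem rist_le_rayOrbitSubgroup {Q : Subgroup G} {ξ : TreeBoundary d} {v : List (Fin d)}
    (hv : ∀ q ∈ Q, (q • ξ).vertex v.length ≠ v) : rist G v ≤ rayOrbitSubgroup Q ξ :=
  le_sup_of_le_right (le_iSup_of_le (⟨v, hv⟩ : {v : List (Fin d) //
    ∀ q ∈ Q, (q • ξ).vertex v.length ≠ v}) le_rfl)

theorem smul_eq_self_of_mem_rist {v : List (Fin d)} {ξ : TreeBoundary d}
    (hv : ξ.vertex v.length ≠ v) {g : G} (hg : g ∈ rist G v) : g • ξ = ξ := by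
  refine TreeBoundary.ext (funext fun n => hg _ fun h => hv ?_)
  have hn : v.length ≤ n := h.length_le.trans (ξ.length_vertex n).le
  exact ((List.prefix_of_prefix_length_le (ξ.vertex_prefix_of_le hn) h
    (ξ.length_vertex _).le).eq_of_length (ξ.length_vertex _))

-- Elements of `Q` permute the orbit, and the rigid stabilizers involved fix it pointwise.
open scoped Pointwise in
theorem rayOrbitSubgroup_le_stabilizer (Q : Subgroup G) (ξ : TreeBoundary d) :
    rayOrbitSubgroup Q ξ ≤ MulAction.stabilizer G (MulAction.orbit Q ξ) := by
  refine sup_le ?_ (iSup_le ?_)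
  · intro q hq
    exact MulAction.smul_orbit (⟨q, hq⟩ : Q) ξ
  · rintro ⟨v, hv⟩ g hg
    rw [MulAction.mem_stabilizer_set]
    intro η
    have hfix : ∀ η ∈ MulAction.orbit Q ξ, g • η = η := by
      rintro _ ⟨q, rfl⟩
      exact smul_eq_self_of_mem_rist (hv q.1 q.2) hg
    constructor
    · intro h
      have h1 := hfix _ h
      rw [MulAction.injective g h1] at h
      exact h
    · intro h
      rw [hfix _ h]
      exact h

-- The orbit of `ξ` under this subgroup stays in the finite set `Qξ`, so the stabilizer of `ξ` would
-- inherit finite index in `G`.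
open scoped Pointwise in
theorem SphericallyTransitive.not_finiteIndex_rayOrbitSubgroup (hd : 2 ≤ d)
    (hG : SphericallyTransitive G) (Q : Subgroup G) [Finite Q] (ξ : TreeBoundary d) :
    ¬ (rayOrbitSubgroup Q ξ).FiniteIndex := by
  intro hfin
  set H := rayOrbitSubgroup Q ξ with hH
  have horb : (MulAction.orbit H ξ).Finite := by
    refine (Finite.finite_mulAction_orbit (M := Q) ξ).subset ?_
    rintro _ ⟨g, rfl⟩
    exact (MulAction.mem_stabilizer_set.1 (rayOrbitSubgroup_le_stabilizer Q ξ g.2) ξ).2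
      (MulAction.mem_orbit_self ξ)
  have h1 : (MulAction.stabilizer H ξ).FiniteIndex := by
    have : Finite (MulAction.orbit H ξ) := horb
    have : Finite (H ⧸ MulAction.stabilizer H ξ) :=
      Finite.of_equiv _ (MulAction.orbitEquivQuotientStabilizer H ξ)
    exact Subgroup.finiteIndex_of_finite_quotient
  have h2 : (MulAction.stabilizer G ξ).relIndex H ≠ 0 := h1.index_ne_zero
  have h3 := Subgroup.relIndex_ne_zero_trans (L := ⊤) h2
    (by rw [Subgroup.relIndex_top_right]; exact hfin.index_ne_zero)
  rw [Subgroup.relIndex_top_right] at h3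
  exact hG.not_finiteIndex_stabilizer hd ξ ⟨h3⟩

/-- Only rays in the same `Q`-orbit have their subgroups contained in a common subgroup of infinite
index. -/
theorem IsRegularBranchOver.mem_orbit_of_rayOrbitSubgroup_le (h : IsRegularBranchOver G K)
    {Q W : Subgroup G} [Finite Q] (hW : ¬ W.FiniteIndex) {ξ η : TreeBoundary d}
    (hξ : rayOrbitSubgroup Q ξ ≤ W) (hη : rayOrbitSubgroup Q η ≤ W) :
    η ∈ MulAction.orbit Q ξ := by
  by_contra hne
  have h1 : ∀ q : Q, ∃ n, (q • ξ).vertex n ≠ η.vertex n := fun q =>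
    TreeBoundary.exists_vertex_ne fun h => hne ⟨q, h⟩
  choose n hn using h1
  -- Finiteness of `Q` gives one level on which `η` is separated from the whole orbit of `ξ`.
  obtain ⟨N, hN⟩ := (Set.finite_range n).bddAbove
  have h2 : ∀ q : Q, (q • ξ).vertex N ≠ η.vertex N := fun q =>
    TreeBoundary.vertex_ne_of_le (hN ⟨q, rfl⟩) (hn q)
  have hle : (⨆ v : {v : List (Fin d) // v.length = N}, rist G v.1) ≤ W := by
    refine iSup_le fun v => ?_
    by_cases hv : ∀ q ∈ Q, (q • ξ).vertex v.1.length ≠ v.1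
    · exact (rist_le_rayOrbitSubgroup hv).trans hξ
    · refine (rist_le_rayOrbitSubgroup fun q hq hqv => hv fun p hp hpv => ?_).trans hη
      rw [v.2] at hqv hpv
      -- A vertex on both orbits would make a translate of `ξ` agree with `η` on level `N`.
      refine h2 (⟨q, hq⟩⁻¹ * ⟨p, hp⟩) ?_
      have h3 : p.1 • ξ.vertex N = q.1 • η.vertex N := hpv.trans hqv.symm
      change (q.1⁻¹ * p.1) • ξ.vertex N = η.vertex N
      rw [mul_smul, h3, inv_smul_smul]
  have := h.finiteIndex_iSup_rist N
  exact hW (Subgroup.finiteIndex_of_le hle)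

end TreeAut

/-! ### Counting the classes -/

theorem corollary1p2 (d : ℕ) (hd : 2 ≤ d) (G : Subgroup (TreeAut d)) (hfg : Group.FG G)
    (hG : TreeAut.IsRegularBranch G) (Q : Subgroup G) (hQ : Finite Q)
    (hfix : ¬ ∃ ξ : TreeBoundary d, ∀ q ∈ Q, q • ξ = ξ) :
    ¬ Set.Countable {c : AutClass G |
      (∃ W : Subgroup G, IsWeaklyMaximal W ∧ autClass W = c) ∧
      ∀ P : Subgroup G, IsParabolic P → autClass P ≠ c} := by
  intro hcount
  obtain ⟨K, hK⟩ := hG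
  choose W hle hW using fun ξ : TreeBoundary d => exists_le_isWeaklyMaximal
    (hK.sphericallyTransitive.not_finiteIndex_rayOrbitSubgroup hd Q ξ)
  have hmem : ∀ ξ, autClass (W ξ) ∈ {c : AutClass G |
      (∃ W : Subgroup G, IsWeaklyMaximal W ∧ autClass W = c) ∧
      ∀ P : Subgroup G, IsParabolic P → autClass P ≠ c} := by
    refine fun ξ => ⟨⟨W ξ, hW ξ, rfl⟩, ?_⟩
    rintro _ ⟨ζ, rfl⟩ heq
    obtain ⟨φ, hφ⟩ : ∃ φ : G ≃* G, (MulAction.stabilizer G ζ).map φ.toMonoidHom = W ξ :=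
      Quotient.exact heq
    obtain ⟨η, hη⟩ := hK.exists_map_stabilizer_le hd φ ζ
    rw [hφ] at hη
    exact hfix ⟨η, fun q hq => hη (hle ξ ((le_sup_left : Q ≤ _) hq))⟩
  have hAut := countable_mulEquiv_of_fg G
  have hfib : ∀ c : AutClass G, {ξ | autClass (W ξ) = c}.Countable := by
    intro c
    rcases Set.eq_empty_or_nonempty {ξ | autClass (W ξ) = c} with h0 | ⟨ξ, hξ⟩
    · rw [h0]
      exact Set.countable_empty
    refine Set.Countable.mono (s₂ := ⋃ φ : G ≃* G, {η | (W ξ).map φ.toMonoidHom = W η}) ?_ ?_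
    · intro η hη
      have : autClass (W ξ) = autClass (W η) := Eq.trans hξ (Eq.symm hη)
      obtain ⟨φ, hφ⟩ : ∃ φ : G ≃* G, (W ξ).map φ.toMonoidHom = W η := Quotient.exact this
      exact Set.mem_iUnion.2 ⟨φ, hφ⟩
    · refine Set.countable_iUnion fun φ => ?_
      rcases Set.eq_empty_or_nonempty {η | (W ξ).map φ.toMonoidHom = W η} with h0 | ⟨η, hη⟩
      · rw [h0]
        exact Set.countable_empty
      -- For a fixed `φ`, all rays in this set share one weakly maximal subgroup, so they lie in one
      -- finite `Q`-orbit.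
      refine (Finite.finite_mulAction_orbit (M := Q) η).countable.mono fun θ hθ => ?_
      have hWW : W η = W θ := Eq.trans (Eq.symm hη) hθ
      refine hK.mem_orbit_of_rayOrbitSubgroup_le (hW η).prop (hle η) ?_
      rw [hWW]
      exact hle θ
  refine TreeBoundary.not_countable hd (Set.countable_univ_iff.1 ?_)
  refine (hcount.biUnion fun c _ => hfib c).mono fun ξ _ => ?_
  exact Set.mem_iUnion₂.2 ⟨_, hmem ξ, rfl⟩
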